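/- Let $X$ be a symmetric selfdecomposable real random variable (that is, $X\stackrel{d}{=}-X$), with the random integral representation $$X\stackrel{d}{=}\int_0^\infty e^{-s}\,dY(s),\qquad \mathbb{E}[\log(1+|Y(1)|)]<\infty,$$ where $(Y(t))_{t\ge 0}$ is a Lévy process (the background driving Lévy process of $X$); here $\int_{(0,T]}e^{-s}\,dY(s)$ is the pathwise integral defined by integration by parts, and $\int_0^\infty$ is its limit in probability as $T\to\infty$. Let $\phi(t)=\mathbb{E}[e^{itX}]$ be the characteristic function of $X$ and let $G_X(a)=P(Y(1)\le a)$, $a\in\mathbb{R}$, be the background driving distribution function (BDDF) of $X$. Then $\phi(t)\neq 0$ and $\phi$ is differentiable at every $t\ne 0$, and at every continuity point $a$ of $G_X$, $$G_X(a)=\frac12+\frac1\pi\int_0^\infty \exp\Big[t\,\frac{\phi'(t)}{\phi(t)}\Big]\,\sin(ta)\,\frac{dt}{t},$$ where the integrand is integrable on $(0,T]$ for every $T>0$ and the integral is the improper one, $\lim_{T\to\infty}\int_0^T$. -/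

import Mathlib

open MeasureTheory ProbabilityTheory Filter Topology
open scoped NNReal

namespace Selfdecomp

/-- A real-valued path on `[0, ∞)` is càdlàg: right-continuous with finite left limits. -/
def IsCadlagPath (y : ℝ≥0 → ℝ) : Prop :=
  ∀ t : ℝ≥0, ContinuousWithinAt y (Set.Ici t) t ∧ ∃ l : ℝ, Tendsto y (𝓝[<] t) (𝓝 l)

/-- A real-valued Lévy process `Y(t)`, `t ≥ 0`, on the probability space `(Ω, P)`. -/
structure IsLevyProcess {Ω : Type*} [MeasurableSpace Ω] (P : Measure Ω)
    (Y : ℝ≥0 → Ω → ℝ) : Prop where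
  aemeasurable : ∀ t, AEMeasurable (Y t) P
  start_zero : ∀ᵐ ω ∂P, Y 0 ω = 0
  indep_increments : HasIndepIncrements Y P
  stationary_increments : ∀ s h : ℝ≥0,
    IdentDistrib (fun ω => Y (s + h) ω - Y s ω) (fun ω => Y h ω - Y 0 ω) P P
  stochastically_continuous : ∀ t : ℝ≥0, TendstoInMeasure P Y (𝓝 t) (Y t)
  cadlag : ∀ᵐ ω ∂P, IsCadlagPath (fun t => Y t ω)

/-- The random integral `∫_{(0,T]} e^{-s} dY(s)`. Since `s ↦ e^{-s}` is continuous and of bounded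
variation and the paths of `Y` are càdlàg, it is the pathwise Riemann–Stieltjes integral, given by
integration by parts:
`e^{-T} Y(T) - e^{-0} Y(0) - ∫_0^T Y(s) d(e^{-s}) = e^{-T} Y(T) - Y(0) + ∫_0^T e^{-s} Y(s) ds`. -/
noncomputable def expIntegral {Ω : Type*} (Y : ℝ≥0 → Ω → ℝ) (T : ℝ≥0) (ω : Ω) : ℝ :=
  Real.exp (-(T : ℝ)) * Y T ω - Y 0 ω + ∫ s in (0 : ℝ)..(T : ℝ), Real.exp (-s) * Y s.toNNReal ω

/-- `Z = ∫_0^∞ e^{-s} dY(s)`: the improper random integral, as the limit in probability of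
`∫_{(0,T]} e^{-s} dY(s)` for `T → ∞` (so, in particular, an almost sure limit qualifies). -/
def IsImproperExpIntegral {Ω : Type*} [MeasurableSpace Ω] (P : Measure Ω)
    (Y : ℝ≥0 → Ω → ℝ) (Z : Ω → ℝ) : Prop :=
  TendstoInMeasure P (expIntegral Y) atTop Z

/-- `Y` is a background driving Lévy process of the random variable `X`: it is a Lévy process with
`E[log (1 + |Y(1)|)] < ∞`, and `X` has the random integral representation
`X = ∫_0^∞ e^{-s} dY(s)` in distribution. (`X` and `Y` may live on different probability spaces.)
A random variable `X` which admits such a representation is selfdecomposable. -/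
structure IsBDLP {Ω Ω' : Type*} [MeasurableSpace Ω] [MeasurableSpace Ω'] (P : Measure Ω)
    (Y : ℝ≥0 → Ω → ℝ) (P' : Measure Ω') (X : Ω' → ℝ) : Prop where
  levy : IsLevyProcess P Y
  log_moment : Integrable (fun ω => Real.log (1 + |Y 1 ω|)) P
  representation : ∃ Z : Ω → ℝ, IsImproperExpIntegral P Y Z ∧ IdentDistrib X Z P' P

/-- The background driving distribution function `a ↦ P(Y(1) ≤ a)`. -/
noncomputable def bddf {Ω : Type*} [MeasurableSpace Ω] (P : Measure Ω) (Y : ℝ≥0 → Ω → ℝ)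
    (a : ℝ) : ℝ :=
  P.real {ω | Y 1 ω ≤ a}

/-- A real random variable `X` is symmetric: `X` and `-X` have the same distribution. -/
def IsSymmetricRV {Ω' : Type*} [MeasurableSpace Ω'] (P' : Measure Ω') (X : Ω' → ℝ) : Prop :=
  IdentDistrib X (fun ω => -X ω) P' P'

/-- The integrand `exp[t φ'(t)/φ(t)] sin(ta) / t`. -/
noncomputable def inversionIntegrand (φ : ℝ → ℂ) (a t : ℝ) : ℂ :=
  Complex.exp ((t : ℂ) * (deriv φ t / φ t)) * (Real.sin (t * a) : ℂ) / (t : ℂ)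

end Selfdecomp

/-! Let `Φ` be the Lévy exponent, so that `Y(t)` has characteristic function `exp(tΦ)`
(`exists_exponent`). Approximation by sums of scaled independent increments shows that `∫_{(0,T]}
e^{-s} dY(s)` has characteristic function `exp ∫_0^T Φ(e^{-s}u) ds` (`charFun_expIntegral`), which
tends to `φ(u)` as `T → ∞`. Splitting the integral at `S` gives `φ(u) = exp(∫_0^S Φ(e^{-s}u) ds) ·
φ(e^{-S}u)` (`eq_exp_integral_mul`). Large `S` forces `φ(u) ≠ 0`, since `φ` is continuous with `φ(0)
= 1`; the choice `S = log u` gives `u φ'(u)/φ(u) = Φ(u)` for `u > 0`.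

Hence the exponential in the integrand is the characteristic function of `Y(1)`. Symmetry of `X`
makes `φ` real, so this function is real too and `Y(1)` is symmetric. The claim is then Gil-Pelaez
inversion for `Y(1)` (`tendsto_integral_re_charFun_mul_sinc`), which rests on the Dirichlet
integral. -/

namespace Selfdecomp

/-! ### The Dirichlet integral, with a rate and a uniform bound. -/

section Dirichlet

lemma integral_sin_mul_exp (t x : ℝ) :
    ∫ u in (0 : ℝ)..x, Real.sin u * Real.exp (-(u * t)) =
      (1 + t ^ 2)⁻¹ - Real.exp (-(x * t)) * ((Real.cos x + t * Real.sin x) / (1 + t ^ 2)) := by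
  have ht : (1 + t ^ 2) ≠ 0 := by positivity
  have hd (u : ℝ) : HasDerivAt
      (fun u => -(Real.exp (-(u * t)) * ((Real.cos u + t * Real.sin u) / (1 + t ^ 2))))
      (Real.sin u * Real.exp (-(u * t))) u := by
    have h1 : HasDerivAt (fun u : ℝ => Real.exp (-(u * t))) (Real.exp (-(u * t)) * (-(1 * t))) u :=
      (((hasDerivAt_id u).mul_const t).neg).exp
    have h2 := (((Real.hasDerivAt_cos u).add ((Real.hasDerivAt_sin u).const_mul t)).div_const
      (1 + t ^ 2))
    refine ((h1.mul h2).neg).congr_deriv ?_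
    simp only [Pi.add_apply]
    field_simp
    ring
  rw [intervalIntegral.integral_eq_sub_of_hasDerivAt (fun u _ => hd u)]
  · simp
    ring
  · exact Continuous.intervalIntegrable (by fun_prop) _ _

/-- The sine integral `∫_0^x (sin t) / t dt`. -/
noncomputable def sineIntegral (x : ℝ) : ℝ := ∫ t in (0 : ℝ)..x, Real.sinc t

lemma continuous_sineIntegral : Continuous sineIntegral :=
  intervalIntegral.continuous_primitive (fun _ _ => Real.continuous_sinc.intervalIntegrable _ _) 0

lemma sineIntegral_neg (x : ℝ) : sineIntegral (-x) = -sineIntegral x := by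
  unfold sineIntegral
  have := intervalIntegral.integral_comp_neg (a := 0) (b := x) (f := Real.sinc)
  simp only [Real.sinc_neg, neg_zero] at this
  rw [this, intervalIntegral.integral_symm]

lemma integral_Ioi_exp_neg_mul {u : ℝ} (hu : 0 < u) :
    ∫ t in Set.Ioi (0 : ℝ), Real.exp (-(u * t)) = u⁻¹ := by
  have := integral_exp_mul_Ioi (a := -u) (by linarith) 0
  simp only [neg_mul] at this
  rw [this]
  simp [neg_div_neg_eq]

lemma integrableOn_Ioi_exp_neg_mul {u : ℝ} (hu : 0 < u) :
    IntegrableOn (fun t => Real.exp (-(u * t))) (Set.Ioi (0 : ℝ)) := by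
  have := integrableOn_exp_mul_Ioi (a := -u) (by linarith) 0
  simpa only [neg_mul] using this

/-- Fubini applied to `1/u = ∫_0^∞ e^{-ut} dt`. The first term integrates to `π/2`; the second
vanishes as `x → ∞`. -/
lemma sineIntegral_eq {x : ℝ} (hx : 0 < x) :
    sineIntegral x = ∫ t in Set.Ioi (0 : ℝ), ((1 + t ^ 2)⁻¹ -
      Real.exp (-(x * t)) * ((Real.cos x + t * Real.sin x) / (1 + t ^ 2))) := by
  have hint : Integrable (Function.uncurry fun u t : ℝ => Real.sin u * Real.exp (-(u * t)))
      ((volume.restrict (Set.Ioc 0 x)).prod (volume.restrict (Set.Ioi 0))) := by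
    rw [integrable_prod_iff (by fun_prop)]
    constructor
    · filter_upwards [ae_restrict_mem measurableSet_Ioc] with u hu
      exact (integrableOn_Ioi_exp_neg_mul hu.1).const_mul (Real.sin u)
    · refine Integrable.congr (f := fun u => |Real.sinc u|) ?_ ?_
      · exact (Real.continuous_sinc.abs.intervalIntegrable 0 x).1
      · filter_upwards [ae_restrict_mem measurableSet_Ioc] with u hu
        simp only [Function.uncurry_apply_pair, norm_mul, Real.norm_eq_abs, Real.abs_exp]
        rw [integral_const_mul, integral_Ioi_exp_neg_mul hu.1, Real.sinc_of_ne_zero hu.1.ne',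
          abs_div, abs_of_pos hu.1, div_eq_mul_inv]
  have hswap := integral_integral_swap hint
  calc sineIntegral x
      = ∫ u in Set.Ioc 0 x, ∫ t in Set.Ioi (0 : ℝ), Real.sin u * Real.exp (-(u * t)) := by
        rw [sineIntegral, intervalIntegral.integral_of_le hx.le]
        refine setIntegral_congr_fun measurableSet_Ioc fun u hu => ?_
        rw [integral_const_mul, integral_Ioi_exp_neg_mul hu.1, Real.sinc_of_ne_zero hu.1.ne',
          div_eq_mul_inv]
    _ = _ := by
        rw [hswap]
        congr 1 with t
        rw [← intervalIntegral.integral_of_le hx.le, integral_sin_mul_exp]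

/-- The constant comes from `|cos x + t sin x| ≤ 1 + t ≤ 2(1 + t²)`, and `∫_0^∞ e^{-xt} dt = 1/x`.
-/
lemma abs_sineIntegral_sub_le {x : ℝ} (hx : 0 < x) :
    |sineIntegral x - Real.pi / 2| ≤ 2 / x := by
  have hb (t : ℝ) (ht : 0 < t) :
      ‖Real.exp (-(x * t)) * ((Real.cos x + t * Real.sin x) / (1 + t ^ 2))‖ ≤
        2 * Real.exp (-(x * t)) := by
    rw [norm_mul, mul_comm]
    refine mul_le_mul ?_ (by simp) (norm_nonneg _) (by norm_num)
    rw [norm_div, Real.norm_of_nonneg (by positivity : 0 ≤ 1 + t ^ 2), div_le_iff₀ (by positivity),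
      Real.norm_eq_abs, abs_le]
    have h1 := Real.abs_cos_le_one x
    have h2 := Real.abs_sin_le_one x
    rw [abs_le] at h1 h2
    constructor <;> nlinarith [sq_nonneg (t - 1), mul_nonneg ht.le (sub_nonneg.2 h2.2),
      mul_nonneg ht.le (neg_le_iff_add_nonneg.1 h2.1)]
  have hi2 : IntegrableOn (fun t => 2 * Real.exp (-(x * t))) (Set.Ioi (0 : ℝ)) :=
    (integrableOn_Ioi_exp_neg_mul hx).const_mul 2
  have hi : IntegrableOn
      (fun t => Real.exp (-(x * t)) * ((Real.cos x + t * Real.sin x) / (1 + t ^ 2)))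
      (Set.Ioi (0 : ℝ)) := by
    refine hi2.mono' (Measurable.aestronglyMeasurable (by fun_prop)) ?_
    filter_upwards [ae_restrict_mem measurableSet_Ioi] with t ht using hb t ht
  have hinv : IntegrableOn (fun t : ℝ => (1 + t ^ 2)⁻¹) (Set.Ioi (0 : ℝ)) :=
    integrable_inv_one_add_sq.integrableOn
  rw [sineIntegral_eq hx, integral_sub hinv hi, integral_Ioi_inv_one_add_sq, Real.arctan_zero,
    sub_zero, sub_sub_cancel_left, abs_neg, ← Real.norm_eq_abs]
  refine (norm_integral_le_of_norm_le hi2 ?_).trans_eq ?_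
  · filter_upwards [ae_restrict_mem measurableSet_Ioi] with t ht using hb t ht
  · rw [integral_const_mul, integral_Ioi_exp_neg_mul hx, div_eq_mul_inv]

lemma tendsto_sineIntegral_atTop : Tendsto sineIntegral atTop (𝓝 (Real.pi / 2)) := by
  rw [tendsto_iff_norm_sub_tendsto_zero]
  refine squeeze_zero' (.of_forall fun _ => norm_nonneg _) ?_
    (tendsto_const_nhds.div_atTop tendsto_id : Tendsto (fun x : ℝ => 2 / x) atTop (𝓝 0))
  filter_upwards [eventually_gt_atTop 0] with x hx using abs_sineIntegral_sub_le hx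

/-- Supplies the dominating constant in the inversion formula; for `x > 1` it is `π/2 + 2/x ≤ 2 +
2`. -/
lemma abs_sineIntegral_le (x : ℝ) : |sineIntegral x| ≤ 4 := by
  wlog hx : 0 ≤ x generalizing x
  · rw [← abs_neg, ← sineIntegral_neg]
    exact this _ (by linarith)
  rcases le_or_gt x 1 with h | h
  · have := intervalIntegral.norm_integral_le_of_norm_le_const (a := 0) (b := x) (C := 1)
      (f := Real.sinc) fun t _ => Real.abs_sinc_le_one t
    rw [Real.norm_eq_abs, sub_zero, abs_of_nonneg hx] at this
    exact this.trans (by linarith)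
  · have h1 := abs_sineIntegral_sub_le (zero_lt_one.trans h)
    have h2 : 2 / x ≤ 2 := div_le_self (by norm_num) h.le
    have h3 := abs_sub_abs_le_abs_sub (sineIntegral x) (Real.pi / 2)
    rw [abs_of_pos (by positivity : 0 < Real.pi / 2)] at h3
    linarith [Real.pi_le_four]

lemma tendsto_sineIntegral_mul (c : ℝ) :
    Tendsto (fun T => sineIntegral (T * c)) atTop (𝓝 (Real.pi / 2 * SignType.sign c)) := by
  have hpos {c : ℝ} (hc : 0 < c) :
      Tendsto (fun T => sineIntegral (T * c)) atTop (𝓝 (Real.pi / 2)) :=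
    tendsto_sineIntegral_atTop.comp (tendsto_id.atTop_mul_const hc)
  rcases lt_trichotomy c 0 with hc | hc | hc
  · have := (hpos (neg_pos.2 hc)).neg
    simpa [sign_neg hc, sineIntegral_neg] using this
  · simp [hc, sineIntegral]
  · simpa [sign_pos hc] using hpos hc

end Dirichlet

/-! ### Gil-Pelaez inversion for symmetric measures. -/

section Inversion

lemma mul_sinc (t c : ℝ) : t * (c * Real.sinc (t * c)) = Real.sin (t * c) := by
  rcases eq_or_ne (t * c) 0 with h | h
  · rw [← mul_assoc, h]; simp
  · rw [Real.sinc_of_ne_zero h, ← mul_assoc, mul_div_cancel₀ _ h]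

/-- The product-to-sum formula for `sin(ta) cos(ty)`, divided by `t`. The form `c * sinc(tc)` of
`sin(tc)/t` removes the singularity at `t = 0`. -/
lemma cos_mul_sinc (t a y : ℝ) :
    Real.cos (t * y) * (a * Real.sinc (t * a)) =
      ((a + y) * Real.sinc (t * (a + y)) + (a - y) * Real.sinc (t * (a - y))) / 2 := by
  rcases eq_or_ne t 0 with rfl | ht
  · simp
  · apply mul_left_cancel₀ ht
    have h1 := mul_sinc t a
    have h2 := mul_sinc t (a + y)
    have h3 := mul_sinc t (a - y)
    rw [mul_add, Real.sin_add] at h2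
    rw [mul_sub, Real.sin_sub] at h3
    rw [mul_add, mul_sub]
    linear_combination Real.cos (t * y) * h1 - h2 / 2 - h3 / 2

lemma integral_mul_sinc (T c : ℝ) :
    ∫ t in (0 : ℝ)..T, c * Real.sinc (t * c) = sineIntegral (T * c) := by
  rw [intervalIntegral.integral_const_mul, intervalIntegral.mul_integral_comp_mul_right, zero_mul,
    sineIntegral]

lemma integral_cos_mul_sinc (T a y : ℝ) :
    ∫ t in (0 : ℝ)..T, Real.cos (t * y) * (a * Real.sinc (t * a)) =
      (sineIntegral (T * (a + y)) + sineIntegral (T * (a - y))) / 2 := by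
  have hc (c : ℝ) : IntervalIntegrable (fun t => c * Real.sinc (t * c)) volume 0 T :=
    (continuous_const.mul
      (Real.continuous_sinc.comp (continuous_id.mul continuous_const))).intervalIntegrable _ _
  simp_rw [cos_mul_sinc]
  rw [intervalIntegral.integral_div, intervalIntegral.integral_add (hc _) (hc _),
    integral_mul_sinc, integral_mul_sinc]

lemma re_charFun (μ : Measure ℝ) [IsProbabilityMeasure μ] (t : ℝ) :
    (charFun μ t).re = ∫ y, Real.cos (t * y) ∂μ := by
  rw [charFun_apply_real]
  have hi : Integrable (fun y : ℝ => Complex.exp (t * y * Complex.I)) μ := by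
    refine Integrable.of_bound (C := 1) (Continuous.aestronglyMeasurable (by fun_prop))
      (.of_forall fun y => ?_)
    rw [← Complex.ofReal_mul, Complex.norm_exp_ofReal_mul_I]
  rw [← RCLike.re_eq_complex_re, ← integral_re hi]
  congr 1 with y
  rw [← Complex.ofReal_mul, RCLike.re_eq_complex_re, Complex.exp_ofReal_mul_I_re]

lemma integral_re_charFun_mul_sinc (μ : Measure ℝ) [IsProbabilityMeasure μ] (a T : ℝ) :
    ∫ t in (0 : ℝ)..T, (charFun μ t).re * (a * Real.sinc (t * a)) =
      ∫ y, (sineIntegral (T * (a + y)) + sineIntegral (T * (a - y))) / 2 ∂μ := by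
  simp_rw [re_charFun, ← integral_mul_const]
  rw [intervalIntegral_integral_swap]
  · simp_rw [integral_cos_mul_sinc]
  · have : IsFiniteMeasure (volume.restrict (Set.uIoc 0 T)) := by
      rw [Set.uIoc]; infer_instance
    refine Integrable.of_bound (C := |a|) ?_ (.of_forall fun p => ?_)
    · have := Real.continuous_sinc
      exact Continuous.aestronglyMeasurable (by unfold Function.uncurry; fun_prop)
    · simp only [Function.uncurry, Real.norm_eq_abs, abs_mul]
      have h1 := Real.abs_cos_le_one (p.1 * p.2)
      have h2 := Real.abs_sinc_le_one (p.1 * a)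
      calc _ ≤ 1 * (|a| * 1) := by gcongr
        _ = |a| := by ring

/-- Reflecting the measure conjugates its characteristic function, so uniqueness applies. Positive
`t` suffice, again by conjugation. -/
lemma map_neg_eq_of_im_charFun_eq_zero (μ : Measure ℝ) [IsProbabilityMeasure μ]
    (h : ∀ t, 0 < t → (charFun μ t).im = 0) : μ.map (fun x => -x) = μ := by
  have h' (t : ℝ) : (charFun μ t).im = 0 := by
    rcases lt_trichotomy t 0 with ht | rfl | ht
    · have := h (-t) (by linarith)
      rw [charFun_neg, Complex.conj_im] at this
      linarith
    · simp
    · exact h t ht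
  have : IsProbabilityMeasure (μ.map fun x => -x) :=
    Measure.isProbabilityMeasure_map (by fun_prop)
  refine Measure.ext_of_charFun ?_
  ext t
  have := charFun_map_mul (μ := μ) (-1) t
  simp only [neg_mul, one_mul] at this
  rw [this, charFun_neg]
  exact Complex.conj_eq_iff_im.2 (h' t)

/-- Gil-Pelaez inversion for a probability measure with real characteristic function. -/
lemma tendsto_integral_re_charFun_mul_sinc (μ : Measure ℝ) [IsProbabilityMeasure μ]
    (hsymm : μ.map (fun x => -x) = μ) {a : ℝ} (ha : μ {a} = 0) :
    Tendsto (fun T => 1 / 2 + 1 / Real.pi *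
      ∫ t in (0 : ℝ)..T, (charFun μ t).re * (a * Real.sinc (t * a))) atTop
      (𝓝 (μ.real (Set.Iic a))) := by
  have hlim : Tendsto
      (fun T => ∫ y, (sineIntegral (T * (a + y)) + sineIntegral (T * (a - y))) / 2 ∂μ) atTop
      (𝓝 (∫ y, (Real.pi / 2 * (SignType.sign (a + y) : ℝ) +
        Real.pi / 2 * (SignType.sign (a - y) : ℝ)) / 2 ∂μ)) := by
    refine tendsto_integral_filter_of_dominated_convergence (fun _ => 4) (.of_forall fun T => ?_)
      (.of_forall fun T => .of_forall fun y => ?_) (integrable_const _) (.of_forall fun y => ?_)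
    · have := continuous_sineIntegral
      exact Continuous.aestronglyMeasurable (by fun_prop)
    · have h1 := abs_le.1 (abs_sineIntegral_le (T * (a + y)))
      have h2 := abs_le.1 (abs_sineIntegral_le (T * (a - y)))
      rw [Real.norm_eq_abs, abs_le]
      constructor <;> linarith [h1.1, h1.2, h2.1, h2.2]
    · exact ((tendsto_sineIntegral_mul _).add (tendsto_sineIntegral_mul _)).div_const 2
  have hmeas : Measurable fun y : ℝ => ((SignType.sign y : SignType) : ℝ) := by
    have h : (fun y : ℝ => ((SignType.sign y : SignType) : ℝ)) =
        fun y => if 0 < y then 1 else if y < 0 then -1 else 0 := by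
      ext y
      rcases lt_trichotomy y 0 with hy | hy | hy
      · simp [hy, hy.not_gt, sign_neg hy]
      · simp [hy]
      · simp [hy, sign_pos hy]
    rw [h]
    exact Measurable.ite measurableSet_Ioi measurable_const
      (Measurable.ite measurableSet_Iio measurable_const measurable_const)
  have hint (g : ℝ → ℝ) (hg : Measurable g) :
      Integrable (fun y => Real.pi / 2 * ((SignType.sign (g y) : SignType) : ℝ)) μ := by
    refine (Integrable.of_bound (C := 1) (hmeas.comp hg).aestronglyMeasurable
      (.of_forall fun y => ?_)).const_mul _
    rcases lt_trichotomy (g y) 0 with hy | hy | hy <;> simp [hy, sign_neg, sign_pos]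
  -- Symmetry of `μ` makes the two halves of the limit equal.
  have hsw : ∫ y, Real.pi / 2 * (SignType.sign (a + y) : ℝ) ∂μ =
      ∫ y, Real.pi / 2 * (SignType.sign (a - y) : ℝ) ∂μ := by
    have hm : AEStronglyMeasurable
        (fun y => Real.pi / 2 * ((SignType.sign (a + y) : SignType) : ℝ)) (μ.map fun x => -x) :=
      ((hmeas.comp (measurable_const_add a)).const_mul _).aestronglyMeasurable
    conv_lhs => rw [← hsymm]
    rw [integral_map (by fun_prop) hm]
    simp [sub_eq_add_neg]
  have hval : ∫ y, Real.pi / 2 * (SignType.sign (a - y) : ℝ) ∂μ =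
      Real.pi / 2 * (2 * μ.real (Set.Iic a) - 1) := by
    rw [integral_const_mul]
    congr 1
    -- The two sides differ only at `y = a`, which is not an atom.
    have hae : (fun y => ((SignType.sign (a - y) : SignType) : ℝ)) =ᵐ[μ]
        fun y => 2 * (Set.Iic a).indicator (fun _ => (1 : ℝ)) y - 1 := by
      have : ∀ᵐ y ∂μ, y ≠ a := by
        rw [ae_iff]; simpa using ha
      filter_upwards [this] with y hy
      rcases lt_or_gt_of_ne hy with h | h
      · rw [sign_pos (sub_pos.2 h), Set.indicator_of_mem (Set.mem_Iic.2 h.le)]; norm_num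
      · rw [sign_neg (sub_neg.2 h), Set.indicator_of_notMem (by simpa using h)]; norm_num
    rw [integral_congr_ae hae, integral_sub
      (((integrable_const _).indicator measurableSet_Iic).const_mul _) (integrable_const _),
      integral_const_mul, integral_indicator measurableSet_Iic]
    simp
  simp_rw [integral_re_charFun_mul_sinc]
  convert (hlim.const_mul (1 / Real.pi)).const_add (1 / 2) using 2
  rw [integral_div, integral_add (hint _ (by fun_prop)) (hint _ (by fun_prop)), hsw, hval]
  field_simp
  ring

end Inversion

/-! ### Continuous multiplicative functions on the half-line. -/

section Semigroup

lemma exists_pos_intervalIntegral_ne_zero {g : ℝ → ℂ} (hc : Continuous g) (h0 : g 0 ≠ 0) :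
    ∃ h : ℝ, 0 < h ∧ ∫ s in (0 : ℝ)..h, g s ≠ 0 := by
  have hd : HasDerivAt (fun x => ∫ s in (0 : ℝ)..x, g s) (g 0) 0 := hc.integral_hasStrictDerivAt 0 0
    |>.hasDerivAt
  have h1 : ∀ᶠ x in 𝓝[>] (0 : ℝ), ∫ s in (0 : ℝ)..x, g s ≠ 0 :=
    (hd.eventually_ne h0).filter_mono (nhdsWithin_mono _ fun x hx => ne_of_gt hx)
  obtain ⟨x, hx, hx'⟩ := (h1.and self_mem_nhdsWithin).exists
  exact ⟨x, hx', hx⟩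

/-- With `J` a primitive of `g`, the functional equation gives `J(x+h) - J(x) = g(x) I`;
differentiating, `g' = c g`. The explicit rate `c` later yields continuity of the exponent in the
frequency, with no branch of the logarithm. -/
lemma eq_exp_of_map_add {g : ℝ → ℂ} (hc : Continuous g)
    (hm : ∀ s t, 0 ≤ s → 0 ≤ t → g (s + t) = g s * g t) {h : ℝ} (hh : 0 < h)
    (hI : ∫ s in (0 : ℝ)..h, g s ≠ 0) {t : ℝ} (ht : 0 ≤ t) :
    g t = Complex.exp (t * ((g h - 1) / ∫ s in (0 : ℝ)..h, g s)) := by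
  set I := ∫ s in (0 : ℝ)..h, g s with hIdef
  set c := (g h - 1) / I with hcdef
  set J : ℝ → ℂ := fun x => ∫ s in (0 : ℝ)..x, g s
  have hJ (x : ℝ) : HasDerivAt J (g x) x := (hc.integral_hasStrictDerivAt 0 x).hasDerivAt
  have hK (x : ℝ) (hx : 0 ≤ x) : J (x + h) - J x = g x * I := by
    have h1 : ∫ s in (0 : ℝ)..h, g (x + s) = g x * I := by
      rw [hIdef, ← intervalIntegral.integral_const_mul]
      refine intervalIntegral.integral_congr fun s hs => ?_
      rw [Set.uIcc_of_le hh.le] at hs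
      exact hm x s hx hs.1
    rw [intervalIntegral.integral_comp_add_left, add_zero] at h1
    rw [← h1, intervalIntegral.integral_interval_sub_left] <;> exact hc.intervalIntegrable _ _
  have hd (x : ℝ) (hx : 0 ≤ x) :
      HasDerivAt (fun x : ℝ => (J (x + h) - J x) * Complex.exp (-(x * c))) 0 x := by
    have h1 : HasDerivAt (fun x : ℝ => Complex.exp (-(x * c)))
        (Complex.exp (-(x * c)) * (-(1 * c))) x :=
      ((Complex.ofRealCLM.hasDerivAt.mul_const c).neg).cexp
    refine ((((hJ (x + h)).comp_add_const x h).sub (hJ x)).mul h1).congr_deriv ?_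
    simp only [Pi.sub_apply]
    rw [hK x hx, hm x h hx hh.le, hcdef]
    field_simp
    ring
  have hconst := constant_of_has_deriv_right_zero (a := 0) (b := t)
    (fun x hx => (hd x hx.1).continuousAt.continuousWithinAt)
    (fun x hx => (hd x hx.1).hasDerivWithinAt) t ⟨ht, le_rfl⟩
  simp only [hK t ht] at hconst
  have h00 : J (0 + h) - J 0 = I := by simp [J, hIdef]
  rw [h00, Complex.ofReal_zero, zero_mul, neg_zero, Complex.exp_zero, mul_one] at hconst
  have h2 : g t * Complex.exp (-(t * c)) = 1 := by
    apply mul_right_cancel₀ hI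
    rw [one_mul]
    linear_combination hconst
  rw [Complex.exp_neg] at h2
  exact (mul_inv_eq_one₀ (Complex.exp_ne_zero _)).1 h2

lemma derivWithin_Ici_of_eq_exp {g : ℝ → ℂ} {c : ℂ}
    (hg : ∀ t : ℝ, 0 ≤ t → g t = Complex.exp (t * c)) : derivWithin g (Set.Ici 0) 0 = c := by
  have h1 : HasDerivAt (fun x : ℝ => Complex.exp (x * c)) (Complex.exp ((0 : ℝ) * c) * (1 * c)) 0 :=
    (Complex.ofRealCLM.hasDerivAt.mul_const c).cexp
  have h2 : HasDerivWithinAt g c (Set.Ici 0) 0 := by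
    refine (h1.hasDerivWithinAt.congr (fun t ht => hg t ht) (hg 0 le_rfl)).congr_deriv ?_
    simp
  exact h2.derivWithin (uniqueDiffWithinAt_Ici 0)

end Semigroup

/-! ### The Lévy exponent. -/

section Levy

variable {Ω : Type*} [MeasurableSpace Ω] {P : Measure Ω}

lemma tendsto_charFun_of_tendstoInDistribution {ι : Type*} {l : Filter ι} [IsProbabilityMeasure P]
    {X : ι → Ω → ℝ} {Z : Ω → ℝ} (h : TendstoInDistribution X l Z (fun _ => P) P) (u : ℝ) :
    Tendsto (fun i => charFun (P.map (X i)) u) l (𝓝 (charFun (P.map Z) u)) := by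
  have := (ProbabilityMeasure.tendsto_iff_forall_integral_rclike_tendsto ℂ).1 h.tendsto
  simp_rw [charFun_eq_integral_innerProbChar]
  exact this (BoundedContinuousFunction.innerProbChar u)

namespace IsLevyProcess

variable [IsProbabilityMeasure P] {Y : ℝ≥0 → Ω → ℝ} (hY : IsLevyProcess P Y)
include hY

omit [IsProbabilityMeasure P] in
lemma charFun_increment (s h : ℝ≥0) :
    charFun (P.map fun ω => Y (s + h) ω - Y s ω) = charFun (P.map (Y h)) := by
  rw [(hY.stationary_increments s h).map_eq]
  congr 1
  refine Measure.map_congr ?_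
  filter_upwards [hY.start_zero] with ω hω
  rw [hω, sub_zero]

lemma charFun_add (s t : ℝ≥0) (u : ℝ) :
    charFun (P.map (Y (s + t))) u = charFun (P.map (Y s)) u * charFun (P.map (Y t)) u := by
  have hind := hY.indep_increments.indepFun_eval_sub (zero_le (a := s))
    (le_self_add : s ≤ s + t) hY.start_zero
  have h := hind.charFun_map_add_eq_mul (hY.aemeasurable s)
    ((hY.aemeasurable (s + t)).sub (hY.aemeasurable s))
  rw [add_sub_cancel] at h
  rw [h, Pi.mul_apply]
  congr 1
  exact congrFun (hY.charFun_increment s t) u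

lemma charFun_zero (u : ℝ) : charFun (P.map (Y 0)) u = 1 := by
  have : P.map (Y 0) = Measure.dirac 0 := by
    rw [Measure.map_congr (g := fun _ => (0 : ℝ)) hY.start_zero, Measure.map_const]
    simp
  rw [this, charFun_dirac]
  simp

lemma continuous_charFun_toNNReal (u : ℝ) :
    Continuous fun t : ℝ => charFun (P.map (Y t.toNNReal)) u := by
  have : Continuous fun t : ℝ≥0 => charFun (P.map (Y t)) u :=
    continuous_iff_continuousAt.2 fun t => tendsto_charFun_of_tendstoInDistribution
      ((hY.stochastically_continuous t).tendstoInDistribution hY.aemeasurable) u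
  exact this.comp continuous_real_toNNReal

/-- The Lévy exponent of a Lévy process: existence and continuity. -/
lemma exists_exponent : ∃ Φ : ℝ → ℂ, Continuous Φ ∧
    ∀ (t : ℝ≥0) (u : ℝ), charFun (P.map (Y t)) u = Complex.exp (t * Φ u) := by
  set g : ℝ → ℝ → ℂ := fun u t => charFun (P.map (Y t.toNNReal)) u with hg
  have hgc (u : ℝ) : Continuous (g u) := hY.continuous_charFun_toNNReal u
  have hg0 (u : ℝ) : g u 0 ≠ 0 := by simp [hg, hY.charFun_zero]
  have hgm (u s t : ℝ) (hs : 0 ≤ s) (ht : 0 ≤ t) : g u (s + t) = g u s * g u t := by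
    simp only [hg]
    rw [Real.toNNReal_add hs ht, hY.charFun_add]
  -- The right derivative at time `0` does not depend on `h`, while the quotient formula for one
  -- fixed `h` holds for all `u` near `u₀` and is continuous at `u₀`.
  set Φ : ℝ → ℂ := fun u => derivWithin (g u) (Set.Ici 0) 0 with hΦ
  have hΦeq (u h : ℝ) (hh : 0 < h) (hI : ∫ s in (0 : ℝ)..h, g u s ≠ 0) :
      Φ u = (g u h - 1) / ∫ s in (0 : ℝ)..h, g u s :=
    derivWithin_Ici_of_eq_exp fun t ht => eq_exp_of_map_add (hgc u) (hgm u) hh hI ht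
  have hprob (t : ℝ≥0) : IsProbabilityMeasure (P.map (Y t)) :=
    Measure.isProbabilityMeasure_map (hY.aemeasurable t)
  refine ⟨Φ, continuous_iff_continuousAt.2 fun u₀ => ?_, fun t u => ?_⟩
  · obtain ⟨h, hh, hI⟩ := exists_pos_intervalIntegral_ne_zero (hgc u₀) (hg0 u₀)
    have hIc : ContinuousAt (fun u => ∫ s in (0 : ℝ)..h, g u s) u₀ := by
      refine intervalIntegral.continuousAt_of_dominated_interval (bound := fun _ => 1)
        (.of_forall fun u => (hgc u).aestronglyMeasurable)
        (.of_forall fun u => .of_forall fun s _ => norm_charFun_le_one _) (by simp)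
        (.of_forall fun s _ => continuous_charFun.continuousAt)
    have hnum : ContinuousAt (fun u => g u h - 1) u₀ :=
      (continuous_charFun.sub continuous_const).continuousAt
    refine (hnum.div hIc hI).congr ?_
    filter_upwards [hIc.eventually_ne hI] with u hu
    exact (hΦeq u h hh hu).symm
  · obtain ⟨h, hh, hI⟩ := exists_pos_intervalIntegral_ne_zero (hgc u) (hg0 u)
    have := eq_exp_of_map_add (hgc u) (hgm u) hh hI t.2
    rw [← hΦeq u h hh hI] at this
    simpa [hg] using this

end IsLevyProcess

end Levy

/-! ### Riemann sums as integrals of step functions. -/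

section StepFunctions

lemma ceil_div_eq_of_mem_Ioc {δ s : ℝ} (hδ : 0 < δ) {k : ℕ}
    (hs : s ∈ Set.Ioc (k * δ) ((k + 1 : ℕ) * δ)) : ⌈s / δ⌉ - 1 = k := by
  have : ⌈s / δ⌉ = (k : ℤ) + 1 := by
    rw [Int.ceil_eq_iff]
    constructor
    · rw [lt_div_iff₀ hδ]; push_cast; simpa using hs.1
    · rw [div_le_iff₀ hδ]; have := hs.2; push_cast at this ⊢; exact this
  rw [this]; ring

lemma sum_integral_smul_step {E : Type*} [NormedAddCommGroup E] [NormedSpace ℝ E]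
    [CompleteSpace E]
    {w : ℝ → ℝ} (hw : Continuous w) (c : ℤ → E) {δ : ℝ} (hδ : 0 < δ) (n : ℕ) :
    ∑ k ∈ Finset.range n, (∫ s in (k * δ)..((k + 1 : ℕ) * δ), w s) • c k =
      ∫ s in (0 : ℝ)..(n * δ), w s • c (⌈s / δ⌉ - 1) := by
  have hle (k : ℕ) : (k : ℝ) * δ ≤ (k + 1 : ℕ) * δ := by gcongr; simp
  have heq (k : ℕ) : Set.EqOn (fun s => w s • c k) (fun s => w s • c (⌈s / δ⌉ - 1))
      (Set.Ioc (k * δ) ((k + 1 : ℕ) * δ)) := fun s hs => by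
    simp only [ceil_div_eq_of_mem_Ioc hδ hs]
  have hint (k : ℕ) : IntervalIntegrable (fun s => w s • c (⌈s / δ⌉ - 1)) volume (k * δ)
      ((k + 1 : ℕ) * δ) := by
    rw [intervalIntegrable_iff_integrableOn_Ioc_of_le (hle k)]
    refine IntegrableOn.congr_fun ?_ (heq k) measurableSet_Ioc
    rw [← intervalIntegrable_iff_integrableOn_Ioc_of_le (hle k)]
    exact (hw.smul continuous_const).intervalIntegrable _ _
  have := intervalIntegral.sum_integral_adjacent_intervals (a := fun k : ℕ => (k : ℝ) * δ) (n := n)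
    (μ := volume) fun k _ => hint k
  rw [Nat.cast_zero, zero_mul] at this
  rw [← this]
  refine Finset.sum_congr rfl fun k _ => ?_
  rw [intervalIntegral.integral_of_le (hle k), intervalIntegral.integral_of_le (hle k),
    ← setIntegral_congr_fun measurableSet_Ioc (heq k), integral_smul_const]

/-- Each sum is the integral of a step function, so dominated convergence applies. It serves both
the paths of `Y` (`w = e^{-s}`) and the exponent (`w = 1`). -/
lemma tendsto_sum_integral_smul {E : Type*} [NormedAddCommGroup E] [NormedSpace ℝ E]
    [CompleteSpace E]
    [MeasurableSpace E] [BorelSpace E] [SecondCountableTopology E]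
    {w : ℝ → ℝ} (hw : Continuous w) {T : ℝ} (hT : 0 < T) (c : ℕ → ℤ → E) (f : ℝ → E) (C : ℝ)
    (hb : ∀ n : ℕ, ∀ s ∈ Set.Ioc 0 T, ‖c n (⌈s / (T / (n + 1))⌉ - 1)‖ ≤ C)
    (hlim : ∀ s ∈ Set.Ioc 0 T,
      Tendsto (fun n : ℕ => c n (⌈s / (T / (n + 1))⌉ - 1)) atTop (𝓝 (f s))) :
    Tendsto (fun n : ℕ => ∑ k ∈ Finset.range (n + 1),
        (∫ s in (k * (T / (n + 1)))..((k + 1 : ℕ) * (T / (n + 1))), w s) • c n k)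
      atTop (𝓝 (∫ s in (0 : ℝ)..T, w s • f s)) := by
  have hδ (n : ℕ) : 0 < T / (n + 1) := by positivity
  have hnT (n : ℕ) : ((n + 1 : ℕ) : ℝ) * (T / (n + 1)) = T := by push_cast; field_simp
  simp_rw [sum_integral_smul_step hw _ (hδ _), hnT]
  refine intervalIntegral.tendsto_integral_filter_of_dominated_convergence (fun s => |w s| * C)
    (.of_forall fun n => ?_) (.of_forall fun n => .of_forall fun s hs => ?_)
    ((hw.abs.mul continuous_const).intervalIntegrable _ _) (.of_forall fun s hs => ?_)
  · have h1 : Measurable fun s : ℝ => ⌈s / (T / (n + 1))⌉ - 1 := by fun_prop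
    have h2 : Measurable fun s : ℝ => c n (⌈s / (T / (n + 1))⌉ - 1) :=
      (Measurable.of_discrete (f := c n)).comp h1
    exact (hw.measurable.smul h2).aestronglyMeasurable
  · rw [Set.uIoc_of_le hT.le] at hs
    rw [norm_smul, Real.norm_eq_abs]
    exact mul_le_mul_of_nonneg_left (hb n s hs) (abs_nonneg _)
  · rw [Set.uIoc_of_le hT.le] at hs
    exact (hlim s hs).const_smul _

lemma ceil_div_mul_mem_Icc {T s : ℝ} (hs : s ∈ Set.Ioc 0 T) (n : ℕ) :
    (⌈s / (T / (n + 1))⌉ : ℝ) * (T / (n + 1)) ∈ Set.Icc s T ∧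
      (⌈s / (T / (n + 1))⌉ : ℝ) * (T / (n + 1)) ≤ s + T / (n + 1) ∧
      0 ≤ ((⌈s / (T / (n + 1))⌉ : ℝ) - 1) * (T / (n + 1)) := by
  have hT : 0 < T := hs.1.trans_le hs.2
  have hδ : 0 < T / (n + 1) := by positivity
  refine ⟨⟨?_, ?_⟩, ?_, ?_⟩
  · exact (div_le_iff₀ hδ).1 (Int.le_ceil _)
  · rw [← le_div_iff₀ hδ]
    have : ⌈s / (T / (n + 1))⌉ ≤ ((n + 1 : ℕ) : ℤ) := by
      rw [Int.ceil_le, div_le_iff₀ hδ]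
      push_cast
      rw [mul_div_cancel₀ _ (by positivity)]
      exact hs.2
    have h2 : (⌈s / (T / (n + 1))⌉ : ℝ) ≤ ((n + 1 : ℕ) : ℝ) := by exact_mod_cast this
    rw [div_div_cancel₀ hT.ne']
    exact_mod_cast h2
  · have := (Int.ceil_lt_add_one (s / (T / (n + 1)))).le
    have := mul_le_mul_of_nonneg_right this hδ.le
    rwa [add_mul, one_mul, div_mul_cancel₀ _ hδ.ne'] at this
  · have h1 : 0 < ⌈s / (T / (n + 1))⌉ := Int.ceil_pos.2 (div_pos hs.1 hδ)
    have h2 : (1 : ℝ) ≤ ⌈s / (T / (n + 1))⌉ := by exact_mod_cast h1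
    exact mul_nonneg (by linarith) hδ.le

lemma tendsto_div_nat_add_one (T : ℝ) : Tendsto (fun n : ℕ => T / ((n : ℝ) + 1)) atTop (𝓝 0) :=
  tendsto_const_nhds.div_atTop (tendsto_atTop_add_const_right _ _ tendsto_natCast_atTop_atTop)

lemma tendsto_ceil_div_mul {T s : ℝ} (hs : s ∈ Set.Ioc 0 T) :
    Tendsto (fun n : ℕ => (⌈s / (T / (n + 1))⌉ : ℝ) * (T / (n + 1))) atTop (𝓝[≥] s) := by
  refine tendsto_nhdsWithin_iff.2 ⟨?_, .of_forall fun n => (ceil_div_mul_mem_Icc hs n).1.1⟩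
  refine tendsto_of_tendsto_of_tendsto_of_le_of_le tendsto_const_nhds
    (by simpa using (tendsto_div_nat_add_one T).const_add s)
    (fun n => (ceil_div_mul_mem_Icc hs n).1.1) (fun n => (ceil_div_mul_mem_Icc hs n).2.1)

end StepFunctions

/-! ### Pathwise convergence of the Riemann–Stieltjes sums. -/

section Cadlag

/-- One-sided limits bound the path near each point; compactness of `[0, T]` glues the bounds. -/
lemma IsCadlagPath.exists_bound {y : ℝ≥0 → ℝ} (hy : IsCadlagPath y) (T : ℝ≥0) :
    ∃ C, ∀ t ≤ T, |y t| ≤ C := by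
  have : ∃ C, ∀ t ∈ Set.Icc 0 T, |y t| ≤ C := by
    refine isCompact_Icc.induction_on (p := fun s => ∃ C, ∀ t ∈ s, |y t| ≤ C) ⟨0, by simp⟩
      (fun s t hst ⟨C, hC⟩ => ⟨C, fun x hx => hC x (hst hx)⟩) ?_ ?_
    · rintro s t ⟨C, hC⟩ ⟨D, hD⟩
      refine ⟨max C D, fun x hx => ?_⟩
      rcases hx with hx | hx
      · exact (hC x hx).trans (le_max_left _ _)
      · exact (hD x hx).trans (le_max_right _ _)
    · intro t _
      obtain ⟨hr, l, hl⟩ := hy t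
      have h1 : ∀ᶠ x in 𝓝[≥] t, |y x| ≤ |y t| + 1 := by
        filter_upwards [hr.abs.eventually_lt_const (lt_add_one _)] with x hx using hx.le
      have h2 : ∀ᶠ x in 𝓝[<] t, |y x| ≤ |l| + 1 := by
        filter_upwards [hl.abs.eventually_lt_const (lt_add_one _)] with x hx using hx.le
      have h3 : ∀ᶠ x in 𝓝 t, |y x| ≤ max (|l| + 1) (|y t| + 1) := by
        rw [← nhdsLT_sup_nhdsGE, eventually_sup]
        exact ⟨h2.mono fun x hx => hx.trans (le_max_left _ _),
          h1.mono fun x hx => hx.trans (le_max_right _ _)⟩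
      exact ⟨_, mem_nhdsWithin_of_mem_nhds h3, _, fun x hx => hx⟩
  obtain ⟨C, hC⟩ := this
  exact ⟨C, fun t ht => hC t ⟨zero_le, ht⟩⟩

/-- Riemann–Stieltjes sums for `∫_{(0,T]} e^{-s} dY(s)` over the uniform grid with `n + 1` cells. -/
noncomputable def expSum {Ω : Type*} (Y : ℝ≥0 → Ω → ℝ) (T : ℝ≥0) (n : ℕ) (ω : Ω) : ℝ :=
  ∑ k ∈ Finset.range (n + 1), Real.exp (-((k : ℝ) * ((T : ℝ) / (n + 1)))) *
    (Y ((k : ℝ≥0) * (T / (n + 1)) + T / (n + 1)) ω - Y ((k : ℝ≥0) * (T / (n + 1))) ω)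

lemma integral_exp_neg (a b : ℝ) :
    ∫ s in a..b, Real.exp (-s) = Real.exp (-a) - Real.exp (-b) := by
  rw [intervalIntegral.integral_comp_neg (fun s => Real.exp s), integral_exp]

/-- Summation by parts. Weights at left endpoints leave `Y` at right endpoints, so right-continuity
of the path suffices for the limit. -/
lemma expSum_eq {Ω : Type*} (Y : ℝ≥0 → Ω → ℝ) (T : ℝ≥0) (n : ℕ) (ω : Ω) :
    expSum Y T n ω = Real.exp (-(T : ℝ)) * Y T ω - Y 0 ω +
      ∑ k ∈ Finset.range (n + 1),
        (∫ s in (k * ((T : ℝ) / (n + 1)))..((k + 1 : ℕ) * ((T : ℝ) / (n + 1))), Real.exp (-s)) •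
          Y ((((k : ℤ) + 1 : ℤ) : ℝ) * ((T : ℝ) / (n + 1))).toNNReal ω := by
  set δ : ℝ≥0 := T / (n + 1) with hδ
  have hδ' : (T : ℝ) / (n + 1) = (δ : ℝ) := by rw [hδ]; push_cast; rfl
  have hT : ((n + 1 : ℕ) : ℝ≥0) * δ = T := by
    rw [hδ]; push_cast; exact mul_div_cancel₀ _ (by positivity)
  have htel := Finset.sum_range_sub
    (fun k : ℕ => Real.exp (-((k : ℝ) * δ)) * Y ((k : ℝ≥0) * δ) ω) (n + 1)
  rw [hT] at htel
  have hT' : ((n + 1 : ℕ) : ℝ) * (δ : ℝ) = T := by rw [← hT]; push_cast; rfl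
  rw [hT'] at htel
  simp only [Nat.cast_zero, zero_mul, neg_zero, Real.exp_zero, one_mul] at htel
  rw [← htel, expSum, ← Finset.sum_add_distrib]
  refine Finset.sum_congr rfl fun k _ => ?_
  have h1 : ((((k : ℤ) + 1 : ℤ) : ℝ) * ((T : ℝ) / (n + 1))).toNNReal = ((k + 1 : ℕ) : ℝ≥0) * δ := by
    rw [hδ', ← Real.toNNReal_coe (r := ((k + 1 : ℕ) : ℝ≥0) * δ)]
    push_cast; rfl
  rw [h1, hδ', integral_exp_neg, ← hδ, smul_eq_mul,
    show (k : ℝ≥0) * δ + δ = ((k + 1 : ℕ) : ℝ≥0) * δ by push_cast; ring]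
  ring

lemma tendsto_expSum {Ω : Type*} {Y : ℝ≥0 → Ω → ℝ} {ω : Ω} (hy : IsCadlagPath fun t => Y t ω)
    {T : ℝ≥0} (hT : 0 < T) :
    Tendsto (fun n => expSum Y T n ω) atTop (𝓝 (expIntegral Y T ω)) := by
  obtain ⟨C, hC⟩ := hy.exists_bound T
  simp_rw [expSum_eq]
  refine Tendsto.const_add _ ?_
  refine tendsto_sum_integral_smul (w := fun s => Real.exp (-s)) (by fun_prop)
    (NNReal.coe_pos.2 hT) (fun n k => Y (((k + 1 : ℤ) : ℝ) * ((T : ℝ) / (n + 1))).toNNReal ω)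
    (fun s => Y s.toNNReal ω) C (fun n s hs => ?_) (fun s hs => ?_)
  · simp only [sub_add_cancel]
    refine hC _ (Real.toNNReal_le_iff_le_coe.2 (ceil_div_mul_mem_Icc hs n).1.2)
  · simp only [sub_add_cancel]
    have h1 : ContinuousWithinAt (fun r : ℝ => Y r.toNNReal ω) (Set.Ici s) s :=
      (hy s.toNNReal).1.comp continuous_real_toNNReal.continuousWithinAt
        fun r hr => Real.toNNReal_le_toNNReal hr
    exact h1.tendsto.comp (tendsto_ceil_div_mul hs)

end Cadlag

/-! ### Characteristic function of the random integral. -/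

section CharFun

variable {Ω : Type*} [MeasurableSpace Ω] {P : Measure Ω} {Y : ℝ≥0 → Ω → ℝ} (hY : IsLevyProcess P Y)
include hY

lemma IsLevyProcess.aemeasurable_expSum (T : ℝ≥0) (n : ℕ) : AEMeasurable (expSum Y T n) P :=
  Finset.aemeasurable_fun_sum _ fun _ _ =>
    ((hY.aemeasurable _).sub (hY.aemeasurable _)).const_mul _

lemma IsLevyProcess.aemeasurable_expIntegral (T : ℝ≥0) : AEMeasurable (expIntegral Y T) P := by
  rcases eq_or_ne T 0 with rfl | hT
  · have : expIntegral Y 0 = fun _ => 0 := by ext ω; simp [expIntegral]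
    rw [this]; exact aemeasurable_const
  · refine aemeasurable_of_tendsto_metrizable_ae atTop (hY.aemeasurable_expSum T) ?_
    filter_upwards [hY.cadlag] with ω hω using tendsto_expSum hω (pos_iff_ne_zero.2 hT)

lemma IsLevyProcess.charFun_expSum {Φ : ℝ → ℂ}
    (hΦ : ∀ (t : ℝ≥0) (u : ℝ), charFun (P.map (Y t)) u = Complex.exp (t * Φ u))
    (T : ℝ≥0) (n : ℕ) (u : ℝ) :
    charFun (P.map (expSum Y T n)) u = Complex.exp (∑ k ∈ Finset.range (n + 1),
      (((T : ℝ) / (n + 1) : ℝ) : ℂ) * Φ (Real.exp (-((k : ℝ) * ((T : ℝ) / (n + 1)))) * u)) := by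
  set δ : ℝ≥0 := T / (n + 1) with hδ
  have hδ' : (T : ℝ) / (n + 1) = (δ : ℝ) := by rw [hδ]; push_cast; rfl
  have hmono : Monotone fun k : ℕ => (k : ℝ≥0) * δ := fun i j hij => by
    simp only; gcongr
  have hind := hY.indep_increments.nat hmono
  have hind2 := hind.comp (fun (k : ℕ) (x : ℝ) => Real.exp (-((k : ℝ) * δ)) * x)
    fun k => by fun_prop
  have hinc (k : ℕ) : AEMeasurable
      (fun ω => Y (((k + 1 : ℕ) : ℝ≥0) * δ) ω - Y ((k : ℝ≥0) * δ) ω) P :=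
    (hY.aemeasurable _).sub (hY.aemeasurable _)
  have hprod := (hind2.restrict (Finset.range (n + 1))).charFun_map_fun_finsetSum_eq_prod
    fun k _ => (hinc k).const_mul _
  have hsum : expSum Y T n = fun ω => ∑ k ∈ Finset.range (n + 1),
      Real.exp (-((k : ℝ) * δ)) * (Y (((k + 1 : ℕ) : ℝ≥0) * δ) ω - Y ((k : ℝ≥0) * δ) ω) := by
    ext ω
    refine Finset.sum_congr rfl fun k _ => ?_
    rw [hδ', ← hδ,
      show (k : ℝ≥0) * δ + δ = ((k + 1 : ℕ) : ℝ≥0) * δ by push_cast; ring]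
  rw [hsum, hprod, Finset.prod_apply, Complex.exp_sum]
  refine Finset.prod_congr rfl fun k _ => ?_
  have := charFun_map_mul_comp (hinc k) (Real.exp (-((k : ℝ) * δ))) u
  rw [this, show ((k + 1 : ℕ) : ℝ≥0) * δ = (k : ℝ≥0) * δ + δ by push_cast; ring,
    hY.charFun_increment, hΦ, hδ']

/-- The characteristic function of `∫_{(0,T]} e^{-s} dY(s)`. -/
lemma IsLevyProcess.charFun_expIntegral [IsProbabilityMeasure P] {Φ : ℝ → ℂ} (hc : Continuous Φ)
    (hΦ : ∀ (t : ℝ≥0) (u : ℝ), charFun (P.map (Y t)) u = Complex.exp (t * Φ u))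
    {T : ℝ≥0} (hT : 0 < T) (u : ℝ) :
    charFun (P.map (expIntegral Y T)) u =
      Complex.exp (∫ s in (0 : ℝ)..T, Φ (Real.exp (-s) * u)) := by
  have hlim1 : Tendsto (fun n => charFun (P.map (expSum Y T n)) u) atTop
      (𝓝 (charFun (P.map (expIntegral Y T)) u)) := by
    refine tendsto_charFun_of_tendstoInDistribution (tendstoInDistribution_of_ae_tendsto
      (hY.aemeasurable_expSum T) (hY.aemeasurable_expIntegral T) ?_) u
    filter_upwards [hY.cadlag] with ω hω using tendsto_expSum hω hT
  refine tendsto_nhds_unique hlim1 ?_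
  simp_rw [hY.charFun_expSum hΦ]
  -- The exponents are left-endpoint Riemann sums of the continuous function `s ↦ Φ(e^{-s}u)`.
  refine (Complex.continuous_exp.tendsto _).comp ?_
  have hfc : Continuous fun s : ℝ => Φ (Real.exp (-s) * u) := by fun_prop
  obtain ⟨C, hC⟩ := (isCompact_Icc (a := (0 : ℝ)) (b := T)).exists_bound_of_continuousOn
    hfc.continuousOn
  have hmem (s : ℝ) (hs : s ∈ Set.Ioc (0 : ℝ) T) (n : ℕ) :
      ((⌈s / ((T : ℝ) / (n + 1))⌉ - 1 : ℤ) : ℝ) * ((T : ℝ) / (n + 1)) ∈ Set.Icc (0 : ℝ) T := by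
    have h := ceil_div_mul_mem_Icc hs n
    have hδ : 0 ≤ (T : ℝ) / (n + 1) := by positivity
    push_cast
    exact ⟨h.2.2, by linarith [h.1.2]⟩
  have := tendsto_sum_integral_smul (w := fun _ => 1) continuous_const (NNReal.coe_pos.2 hT)
    (fun n k => Φ (Real.exp (-((k : ℝ) * ((T : ℝ) / (n + 1)))) * u))
    (fun s => Φ (Real.exp (-s) * u)) C (fun n s hs => hC _ (hmem s hs n)) (fun s hs => ?_)
  · simp only [one_smul, intervalIntegral.integral_const, smul_eq_mul, mul_one, ← sub_mul] at this
    refine this.congr fun n => Finset.sum_congr rfl fun k _ => ?_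
    push_cast
    rw [add_sub_cancel_left, one_mul, Complex.real_smul]
    push_cast
    rfl
  · refine (hfc.tendsto s).comp ?_
    have h := ((tendsto_ceil_div_mul hs).mono_right nhdsWithin_le_nhds).sub
      (tendsto_div_nat_add_one (T : ℝ))
    rw [sub_zero] at h
    refine h.congr fun n => ?_
    push_cast
    ring

end CharFun

/-! ### Recovering the exponent from the characteristic function. -/

section Exponent

variable {φ Φ : ℝ → ℂ}

lemma integral_exponent_add (hc : Continuous Φ) (S T u : ℝ) :
    ∫ s in (0 : ℝ)..(S + T), Φ (Real.exp (-s) * u) =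
      (∫ s in (0 : ℝ)..S, Φ (Real.exp (-s) * u)) +
        ∫ s in (0 : ℝ)..T, Φ (Real.exp (-s) * (Real.exp (-S) * u)) := by
  have hfc : Continuous fun s : ℝ => Φ (Real.exp (-s) * u) := by fun_prop
  rw [← intervalIntegral.integral_add_adjacent_intervals (hfc.intervalIntegrable 0 S)
    (hfc.intervalIntegrable S (S + T))]
  congr 1
  have := intervalIntegral.integral_comp_add_left (a := 0) (b := T)
    (fun s => Φ (Real.exp (-s) * u)) S
  rw [add_zero] at this
  rw [← this]
  congr 1 with s
  rw [neg_add, Real.exp_add]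
  ring_nf

/-- The tail beyond `S` is the same integral at frequency `e^{-S}u`. Only exponentials pass to the
limit, so convergence of `∫_0^∞ Φ(e^{-s}u) ds` itself is not needed. -/
lemma eq_exp_integral_mul (hc : Continuous Φ)
    (hlim : ∀ u, Tendsto (fun T : ℝ => Complex.exp (∫ s in (0 : ℝ)..T, Φ (Real.exp (-s) * u)))
      atTop (𝓝 (φ u))) (S u : ℝ) :
    φ u = Complex.exp (∫ s in (0 : ℝ)..S, Φ (Real.exp (-s) * u)) * φ (Real.exp (-S) * u) := by
  refine tendsto_nhds_unique ((hlim u).comp (tendsto_atTop_add_const_left _ S tendsto_id)) ?_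
  refine ((hlim (Real.exp (-S) * u)).const_mul _).congr fun T => ?_
  rw [Function.comp_apply, id, integral_exponent_add hc, Complex.exp_add]

lemma ne_zero_of_eq_exp_integral_mul (hφ : Continuous φ) (h0 : φ 0 ≠ 0)
    (h : ∀ S u : ℝ,
      φ u = Complex.exp (∫ s in (0 : ℝ)..S, Φ (Real.exp (-s) * u)) * φ (Real.exp (-S) * u))
    (u : ℝ) : φ u ≠ 0 := by
  have h1 : Tendsto (fun S : ℝ => Real.exp (-S) * u) atTop (𝓝 0) := by
    simpa using (Real.tendsto_exp_neg_atTop_nhds_zero).mul_const u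
  have h2 := ((hφ.tendsto 0).comp h1).eventually_ne h0
  obtain ⟨S, hS⟩ := h2.exists
  rw [h S u]
  exact mul_ne_zero (Complex.exp_ne_zero _) hS

lemma hasDerivAt_of_eq_exp_integral_mul (hc : Continuous Φ)
    (h : ∀ S u : ℝ,
      φ u = Complex.exp (∫ s in (0 : ℝ)..S, Φ (Real.exp (-s) * u)) * φ (Real.exp (-S) * u))
    {u : ℝ} (hu : 0 < u) : HasDerivAt φ (φ u * (Φ u / u)) u := by
  have hgc : Continuous fun r : ℝ => Φ (Real.exp r) := by fun_prop
  have heq : φ =ᶠ[𝓝 u] fun x => Complex.exp (∫ r in (0 : ℝ)..(Real.log x), Φ (Real.exp r)) * φ 1 := by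
    filter_upwards [eventually_gt_nhds hu] with x hx
    -- `S = log x` brings the frequency to `1`; it is negative for `x < 1`, so `h` is needed for all
    -- real `S`.
    rw [h (Real.log x) x, Real.exp_neg, Real.exp_log hx, inv_mul_cancel₀ hx.ne']
    congr 2
    have := intervalIntegral.integral_comp_sub_left (a := 0) (b := Real.log x)
      (fun r => Φ (Real.exp r)) (Real.log x)
    rw [sub_self, sub_zero] at this
    rw [← this]
    congr 1 with s
    rw [sub_eq_neg_add, Real.exp_add, Real.exp_log hx]
  have h1 : HasDerivAt (fun y => ∫ r in (0 : ℝ)..y, Φ (Real.exp r)) (Φ (Real.exp (Real.log u)))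
      (Real.log u) := (hgc.integral_hasStrictDerivAt 0 _).hasDerivAt
  have h2 := ((h1.scomp u (Real.hasDerivAt_log hu.ne')).cexp.mul_const (φ 1))
  refine (h2.congr_of_eventuallyEq heq).congr_deriv ?_
  have hval := heq.self_of_nhds
  simp only [Function.comp_apply] at hval ⊢
  rw [hval, Real.exp_log hu, Complex.real_smul]
  push_cast
  ring

lemma conj_deriv_of_conj_eq (hreal : ∀ t, (starRingEnd ℂ) (φ t) = φ t) (t : ℝ) :
    (starRingEnd ℂ) (deriv φ t) = deriv φ t := by
  by_cases hd : DifferentiableAt ℝ φ t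
  · have h1 := (hd.hasDerivAt).star
    have h2 : (fun x => star (φ x)) = φ := funext hreal
    rw [h2] at h1
    exact h1.deriv.symm
  · rw [deriv_zero_of_not_differentiableAt hd, map_zero]

end Exponent

/-! ### Preparation of the integrand, atoms, and transfer to `X`. -/

lemma inversionIntegrand_eq {φ : ℝ → ℂ} {t r : ℝ} (a : ℝ) (ht : t ≠ 0)
    (h : Complex.exp ((t : ℂ) * (deriv φ t / φ t)) = (r : ℂ)) :
    inversionIntegrand φ a t = ((r * (a * Real.sinc (t * a)) : ℝ) : ℂ) := by
  rw [inversionIntegrand, h, ← mul_sinc t a]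
  have : (t : ℂ) ≠ 0 := by exact_mod_cast ht
  push_cast
  field_simp

lemma measure_singleton_eq_zero_of_continuousAt (μ : Measure ℝ) [IsProbabilityMeasure μ] {a : ℝ}
    (h : ContinuousAt (fun x => μ.real (Set.Iic x)) a) : μ {a} = 0 := by
  have h1 (b : ℝ) (hb : b < a) : μ.real {a} ≤ μ.real (Set.Iic a) - μ.real (Set.Iic b) := by
    have hdisj : Disjoint ({a} : Set ℝ) (Set.Iic b) := by simpa using hb
    have h2 := measureReal_union (μ := μ) hdisj measurableSet_Iic
    have h3 : μ.real ({a} ∪ Set.Iic b) ≤ μ.real (Set.Iic a) := by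
      refine measureReal_mono ?_
      rintro x (rfl | hx)
      · exact Set.self_mem_Iic
      · exact (Set.mem_Iic.1 hx).trans hb.le
    linarith
  have h2 : Tendsto (fun b => μ.real (Set.Iic a) - μ.real (Set.Iic b)) (𝓝[<] a) (𝓝 0) := by
    have := (h.tendsto.mono_left (nhdsWithin_le_nhds (s := Set.Iio a))).const_sub
      (μ.real (Set.Iic a))
    rwa [sub_self] at this
  have h3 : μ.real {a} ≤ 0 := ge_of_tendsto h2 (by
    filter_upwards [self_mem_nhdsWithin] with b hb using h1 b hb)
  exact (measureReal_eq_zero_iff).1 (le_antisymm h3 measureReal_nonneg)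

section BDLP

variable {Ω Ω' : Type*} [MeasurableSpace Ω] [MeasurableSpace Ω'] {P : Measure Ω}
  {P' : Measure Ω'} [IsProbabilityMeasure P] {X : Ω' → ℝ} {Y : ℝ≥0 → Ω → ℝ}

lemma IsBDLP.tendsto_exp_integral (hY : IsBDLP P Y P' X) {Φ : ℝ → ℂ} (hc : Continuous Φ)
    (hΦ : ∀ (t : ℝ≥0) (u : ℝ), charFun (P.map (Y t)) u = Complex.exp (t * Φ u)) (u : ℝ) :
    Tendsto (fun T : ℝ => Complex.exp (∫ s in (0 : ℝ)..T, Φ (Real.exp (-s) * u)))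
      atTop (𝓝 (charFun (P'.map X) u)) := by
  obtain ⟨Z, hZ, hXZ⟩ := hY.representation
  rw [hXZ.map_eq]
  have h1 := (tendsto_charFun_of_tendstoInDistribution
    (hZ.tendstoInDistribution hY.levy.aemeasurable_expIntegral) u).comp Real.tendsto_toNNReal_atTop
  refine h1.congr' ?_
  filter_upwards [eventually_gt_atTop 0] with T hT
  rw [Function.comp_apply, hY.levy.charFun_expIntegral hc hΦ (Real.toNNReal_pos.2 hT),
    Real.coe_toNNReal _ hT.le]

omit [IsProbabilityMeasure P] in
lemma IsSymmetricRV.charFun_neg (hX : IsSymmetricRV P' X) (t : ℝ) :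
    charFun (P'.map X) (-t) = charFun (P'.map X) t := by
  have h := charFun_map_mul_comp hX.aemeasurable_fst (-1) t
  simp only [neg_mul, one_mul] at h
  rw [← h, ← hX.map_eq]

end BDLP

end Selfdecomp

theorem corollary1 {Ω Ω' : Type*} [MeasurableSpace Ω] [MeasurableSpace Ω']
    (P : Measure Ω) [IsProbabilityMeasure P] (P' : Measure Ω') [IsProbabilityMeasure P']
    (X : Ω' → ℝ) (Y : ℝ≥0 → Ω → ℝ)
    (hY : Selfdecomp.IsBDLP P Y P' X)
    (hX : Selfdecomp.IsSymmetricRV P' X) :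
    (∀ t : ℝ, t ≠ 0 →
      DifferentiableAt ℝ (charFun (P'.map X)) t ∧ charFun (P'.map X) t ≠ 0) ∧
    ∀ a : ℝ, ContinuousAt (Selfdecomp.bddf P Y) a →
      (∀ T : ℝ, 0 < T → IntervalIntegrable
        (Selfdecomp.inversionIntegrand (charFun (P'.map X)) a) volume 0 T) ∧
      Tendsto
        (fun T : ℝ => 1 / 2 + 1 / (Real.pi : ℂ) *
          ∫ t in (0 : ℝ)..T, Selfdecomp.inversionIntegrand (charFun (P'.map X)) a t)
        atTop (𝓝 ((Selfdecomp.bddf P Y a : ℝ) : ℂ)) := by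
  open Selfdecomp in
  obtain ⟨Φ, hc, hΦ⟩ := hY.levy.exists_exponent
  have hXm : AEMeasurable X P' := hX.aemeasurable_fst
  have : IsProbabilityMeasure (P'.map X) := Measure.isProbabilityMeasure_map hXm
  have hYm : AEMeasurable (Y 1) P := hY.levy.aemeasurable 1
  have : IsProbabilityMeasure (P.map (Y 1)) := Measure.isProbabilityMeasure_map hYm
  set φ := charFun (P'.map X) with hφ
  set μ := P.map (Y 1) with hμ
  have hmul := eq_exp_integral_mul (φ := φ) hc (hY.tendsto_exp_integral hc hΦ)
  have hne (t : ℝ) : φ t ≠ 0 :=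
    ne_zero_of_eq_exp_integral_mul continuous_charFun (by simp) hmul t
  have heven (t : ℝ) : φ (-t) = φ t := hX.charFun_neg t
  have hderiv {t : ℝ} (ht : 0 < t) : HasDerivAt φ (φ t * (Φ t / t)) t :=
    hasDerivAt_of_eq_exp_integral_mul hc hmul ht
  have hreal (t : ℝ) : (starRingEnd ℂ) (φ t) = φ t := by rw [hφ, ← charFun_neg, ← hφ, heven]
  -- Since `t φ'(t)/φ(t) = Φ(t)`, this is the Lévy formula at time `1`.
  have hexp {t : ℝ} (ht : 0 < t) :
      Complex.exp ((t : ℂ) * (deriv φ t / φ t)) = charFun μ t := by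
    have ht' : (t : ℂ) ≠ 0 := by exact_mod_cast ht.ne'
    rw [(hderiv ht).deriv, mul_div_cancel_left₀ _ (hne t), mul_div_cancel₀ _ ht', hμ, hΦ]
    simp
  have him (t : ℝ) (ht : 0 < t) : (charFun μ t).im = 0 := by
    rw [← Complex.conj_eq_iff_im, ← hexp ht, ← Complex.exp_conj, map_mul, map_div₀, hreal,
      conj_deriv_of_conj_eq hreal, Complex.conj_ofReal]
  have hint (a : ℝ) {t : ℝ} (ht : 0 < t) : inversionIntegrand φ a t =
      (((charFun μ t).re * (a * Real.sinc (t * a)) : ℝ) : ℂ) := by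
    refine inversionIntegrand_eq a ht.ne' ?_
    rw [hexp ht]
    exact Complex.ext (by simp) (by simp [him t ht])
  have hbddf : bddf P Y = fun x => μ.real (Set.Iic x) := by
    ext x
    rw [hμ, map_measureReal_apply_of_aemeasurable hYm measurableSet_Iic]
    rfl
  refine ⟨fun t ht => ⟨?_, hne t⟩, fun a ha => ⟨fun T hT => ?_, ?_⟩⟩
  -- The derivative formula covers `t > 0`; evenness of `φ` handles `t < 0`.
  · rcases lt_or_gt_of_ne ht with ht | ht
    · have h1 : DifferentiableAt ℝ (fun x => φ (-x)) t :=
        ((hderiv (neg_pos.2 ht)).differentiableAt).comp t differentiable_neg.differentiableAt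
      simpa only [heven] using h1
    · exact (hderiv ht).differentiableAt
  · rw [intervalIntegrable_iff_integrableOn_Ioc_of_le hT.le]
    refine IntegrableOn.congr_fun (f := fun t =>
      (((charFun μ t).re * (a * Real.sinc (t * a)) : ℝ) : ℂ)) ?_
      (fun t ht => (hint a ht.1).symm) measurableSet_Ioc
    have h1 := Real.continuous_sinc
    have h2 : Continuous (charFun μ) := continuous_charFun
    exact (Continuous.intervalIntegrable (by fun_prop) 0 T).1
  · rw [hbddf] at ha ⊢
    have hsymm := map_neg_eq_of_im_charFun_eq_zero μ him
    have h := tendsto_integral_re_charFun_mul_sinc μ hsymm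
      (measure_singleton_eq_zero_of_continuousAt μ ha)
    refine ((Complex.continuous_ofReal.tendsto _).comp h).congr' ?_
    filter_upwards [eventually_gt_atTop 0] with T hT
    have : ∫ t in (0 : ℝ)..T, inversionIntegrand φ a t =
        ((∫ t in (0 : ℝ)..T, (charFun μ t).re * (a * Real.sinc (t * a)) : ℝ) : ℂ) := by
      rw [← intervalIntegral.integral_ofReal, intervalIntegral.integral_of_le hT.le,
        intervalIntegral.integral_of_le hT.le]
      exact setIntegral_congr_fun measurableSet_Ioc fun t ht => hint a ht.1
    rw [this]
    simp
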